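/- Let $\Lambda$ be a nonempty finite set and let $q\ge 1$ be an integer. Let $\mathcal H_\Lambda=\bigotimes_{x\in\Lambda}\mathbb C^q$. A state on $\Lambda$ is a positive semidefinite operator on $\mathcal H_\Lambda$ with unit trace. For a state $\rho$, let $S(\rho)=-\mathrm{Tr}[\rho\ln\rho]$ be its von Neumann entropy. For an operator $A$, let $\|A\|_1=\mathrm{Tr}\sqrt{A^\dagger A}$ be its trace norm, and let $\mathrm{Tr}_x$ denote the partial trace over the spin at $x\in\Lambda$. For a traceless self-adjoint operator $\Delta$ on $\mathcal H_\Lambda$, the quantum $W_1$ norm is $$\|\Delta\|_{W_1}=\frac12\min\Big\{\sum_{x\in\Lambda}\|\Delta^{(x)}\|_1 \;:\; \Delta^{(x)}\text{ self-adjoint and traceless on }\mathcal H_\Lambda,\ \mathrm{Tr}_x\Delta^{(x)}=0,\ \sum_{x\in\Lambda}\Delta^{(x)}=\Delta\Big\}.$$ Let $h_2(t)=-t\ln t-(1-t)\ln(1-t)$ for $0\le t\le 1$, with the convention $0\ln 0=0$ throughout. Theorem. For any two states $\rho,\sigma$ on $\Lambda$, $$\frac{|S(\rho)-S(\sigma)|}{|\Lambda|}\;\le\;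 h_2\!\left(\frac{\|\rho-\sigma\|_{W_1}}{|\Lambda|}\right)+\frac{\|\rho-\sigma\|_{W_1}}{|\Lambda|}\,\ln(q^2-1).$$ -/

import Mathlib

open scoped ComplexOrder

/-- Index set of the computational basis of `⨂_{x ∈ Λ} ℂ^q`. -/
abbrev SpinConfig (Λ : Type*) (q : ℕ) : Type _ := Λ → Fin q

/-- Linear operators on `⨂_{x ∈ Λ} ℂ^q`, written as matrices in the computational basis. -/
abbrev SpinOp (Λ : Type*) (q : ℕ) : Type _ := Matrix (SpinConfig Λ q) (SpinConfig Λ q) ℂ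

/-- Quantum states: positive semidefinite operators with unit trace. -/
structure IsQuantumState {Λ : Type*} [Fintype Λ] [DecidableEq Λ] {q : ℕ} (ρ : SpinOp Λ q) :
    Prop where
  posSemidef : ρ.PosSemidef
  trace_eq_one : ρ.trace = 1

/-- Self-adjoint traceless operators. -/
structure IsTracelessSelfAdjoint {Λ : Type*} [Fintype Λ] [DecidableEq Λ] {q : ℕ}
    (A : SpinOp Λ q) : Prop where
  isHermitian : A.IsHermitian
  trace_eq_zero : A.trace = 0

/-- The partial trace `Tr_x` over the spin at `x`, an operator on the spins of `Λ \ {x}`.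
`(Equiv.funSplitAt x (Fin q)).symm (a, i)` is the configuration equal to `a` at `x` and to `i`
elsewhere. -/
def partialTraceSite {Λ : Type*} [DecidableEq Λ] {q : ℕ} (x : Λ) (A : SpinOp Λ q) :
    SpinOp {y : Λ // y ≠ x} q :=
  Matrix.of fun i j => ∑ a : Fin q,
    A ((Equiv.funSplitAt x (Fin q)).symm (a, i)) ((Equiv.funSplitAt x (Fin q)).symm (a, j))

/-- The trace norm `‖A‖₁ = Tr √(A† A)`. -/
noncomputable def traceNorm {ι : Type*} [Fintype ι] [DecidableEq ι] (A : Matrix ι ι ℂ) : ℝ :=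
  (cfc Real.sqrt (A.conjTranspose * A)).trace.re

/-- The von Neumann entropy `S(ρ) = - Tr[ρ ln ρ]`; as `Real.log 0 = 0`, zero eigenvalues
contribute zero. -/
noncomputable def vonNeumannEntropy {ι : Type*} [Fintype ι] [DecidableEq ι]
    (ρ : Matrix ι ι ℂ) : ℝ :=
  -(ρ * cfc Real.log ρ).trace.re

/-- `D` is an admissible decomposition of `Δ`: `∑ x, D x = Δ`, where each `D x` is self-adjoint
and traceless and `Tr_x (D x) = 0`. -/
structure IsW1Decomposition {Λ : Type*} [Fintype Λ] [DecidableEq Λ] {q : ℕ}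
    (Δ : SpinOp Λ q) (D : Λ → SpinOp Λ q) : Prop where
  traceless : ∀ x, IsTracelessSelfAdjoint (D x)
  partialTrace_eq_zero : ∀ x, partialTraceSite x (D x) = 0
  sum_eq : ∑ x, D x = Δ

/-- The quantum `W₁` norm: half the least value of `∑ x, ‖D x‖₁` over the admissible
decompositions `D` of `Δ`. -/
noncomputable def quantumW1Norm {Λ : Type*} [Fintype Λ] [DecidableEq Λ] {q : ℕ}
    (Δ : SpinOp Λ q) : ℝ :=
  1 / 2 * sInf {s : ℝ | ∃ D : Λ → SpinOp Λ q, IsW1Decomposition Δ D ∧ s = ∑ x, traceNorm (D x)}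

/-! Write n for the number of sites, and let ω be the image of ρ under the product of depolarizing
channels of strength s at every site. Klein's inequality (`vonNeumannEntropy_le`) gives S(σ) ≤ -Tr σ
ln ω = -Tr ρ ln ω + Tr (ρ - σ) ln ω.

The first term is at most S(ρ) - n ln c with c = 1 - s + s/q², because each channel dominates c
times the identity map and the logarithm is operator monotone (`neg_trace_mul_log_le_of_smul_le`).
For the second, decompose ρ - σ = ∑ D x. With b = (1 - s)q² + s, ω lies between s and b times an
operator acting trivially at x. The logarithm of that operator is invisible to D x, so what remains
costs at most ½ ln(b/s) ‖D x‖₁ (`trace_mul_log_depolarizeList_le`).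

Setting c = 1 - p turns b/s into (1 - p)(q² - 1)/p, and p = W₁/n makes the sum exactly n times the
claimed bound. This needs s ≤ 1, that is p ≤ 1 - 1/q². For larger p the bound S ≤ n ln q suffices,
since the telescoping decomposition in `exists_isW1Decomposition` gives p ≤ 1 and hence a
nonnegative binary entropy. -/

section
open scoped MatrixOrder Matrix.Norms.L2Operator

/-! ### Trace norm, Klein's inequality and entropy bounds for matrices. -/

namespace Matrix
variable {ι : Type*} [Fintype ι] [DecidableEq ι]

theorem continuousOn_spectrum_real (f : ℝ → ℝ) (A : Matrix ι ι ℂ) :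
    ContinuousOn f (spectrum ℝ A) :=
  (Matrix.finite_real_spectrum).continuousOn f

theorem trace_mul_re_nonneg {A B : Matrix ι ι ℂ} (hA : 0 ≤ A) (hB : 0 ≤ B) :
    0 ≤ (A * B).trace.re := by
  obtain ⟨C, rfl⟩ := CStarAlgebra.nonneg_iff_eq_star_mul_self.mp hA
  rw [mul_assoc, Matrix.trace_mul_comm]
  exact (Complex.nonneg_iff.mp ((nonneg_iff_posSemidef.mp hB).mul_mul_conjTranspose_same C).trace_nonneg).1

theorem trace_mul_re_mono {A B C : Matrix ι ι ℂ} (hA : 0 ≤ A) (hB : B ≤ C) :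
    (A * B).trace.re ≤ (A * C).trace.re := by
  have := trace_mul_re_nonneg hA (sub_nonneg.mpr hB)
  rw [mul_sub, Matrix.trace_sub, Complex.sub_re] at this
  linarith

theorem traceNorm_eq_trace_cfc_abs {D : Matrix ι ι ℂ} (hD : D.IsHermitian) :
    traceNorm D = (cfc (fun x : ℝ => |x|) D).trace.re := by
  have hD' : IsSelfAdjoint D := hD
  have h : D.conjTranspose * D = cfc (fun x : ℝ => x * x) D := by
    rw [hD.eq, cfc_mul (fun x : ℝ => x) (fun x => x) D, cfc_id' ℝ D]
  rw [traceNorm, h, ← cfc_comp' Real.sqrt (fun x : ℝ => x * x) D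
    (Set.Finite.continuousOn (Matrix.finite_real_spectrum.image _) _)]
  simp only [Real.sqrt_mul_self_eq_abs]

theorem traceNorm_neg (D : Matrix ι ι ℂ) : traceNorm (-D) = traceNorm D := by
  simp [traceNorm]

theorem traceNorm_nonneg (D : Matrix ι ι ℂ) : 0 ≤ traceNorm D :=
  (Complex.nonneg_iff.mp (nonneg_iff_posSemidef.mp (cfc_nonneg (a := D.conjTranspose * D)
    fun x _ => Real.sqrt_nonneg x)).trace_nonneg).1

/-- Split D into positive and negative parts, and use the upper bound on G against the first and the
lower bound against the second. -/
theorem trace_mul_re_le_traceNorm {D G : Matrix ι ι ℂ} (hD : D.IsHermitian) {g : ℝ}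
    (h₁ : -(g • (1 : Matrix ι ι ℂ)) ≤ G) (h₂ : G ≤ g • (1 : Matrix ι ι ℂ)) :
    (D * G).trace.re ≤ g * traceNorm D := by
  have hD' : IsSelfAdjoint D := hD
  set P := cfc (fun x : ℝ => max x 0) D
  set N := cfc (fun x : ℝ => max (-x) 0) D
  have hP : 0 ≤ P := cfc_nonneg fun x _ => le_max_right _ _
  have hN : 0 ≤ N := cfc_nonneg fun x _ => le_max_right _ _
  have hPN : D = P - N := by
    rw [← cfc_sub (fun x : ℝ => max x 0) (fun x => max (-x) 0) D]
    conv_lhs => rw [← cfc_id' ℝ D]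
    congr 1; ext x
    rcases le_total x 0 with h | h <;> simp [h]
  have habs : cfc (fun x : ℝ => |x|) D = P + N := by
    rw [← cfc_add D (fun x : ℝ => max x 0) (fun x => max (-x) 0)]
    congr 1; ext x
    rcases le_total x 0 with h | h <;> simp [h, abs_of_nonpos, abs_of_nonneg]
  rw [traceNorm_eq_trace_cfc_abs hD, habs]
  have e₁ := trace_mul_re_mono hP h₂
  have e₂ := trace_mul_re_mono hN h₁
  conv_lhs => rw [hPN]
  simp only [mul_neg, mul_smul_comm, mul_one, trace_neg, trace_smul, Complex.neg_re,
    Complex.smul_re, smul_eq_mul] at e₁ e₂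
  rw [sub_mul, trace_sub, Complex.sub_re, trace_add, Complex.add_re]
  linarith

/-- The modulus of D = P - Q is D · sign D, and sign D lies between -1 and 1. -/
theorem traceNorm_sub_le {P Q : Matrix ι ι ℂ} (hP : 0 ≤ P) (hQ : 0 ≤ Q) :
    traceNorm (P - Q) ≤ P.trace.re + Q.trace.re := by
  have hD : (P - Q).IsHermitian := 
    (nonneg_iff_posSemidef.mp hP).isHermitian.sub (nonneg_iff_posSemidef.mp hQ).isHermitian
  have hD' : IsSelfAdjoint (P - Q) := hD
  set G := cfc (fun x : ℝ => (SignType.sign x : ℝ)) (P - Q)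
  have hc := continuousOn_spectrum_real (fun x : ℝ => (SignType.sign x : ℝ)) (P - Q)
  have hs : ∀ x : ℝ, -1 ≤ (SignType.sign x : ℝ) ∧ (SignType.sign x : ℝ) ≤ 1 := by
    intro x
    cases SignType.sign x <;> norm_num
  have hG₁ : G ≤ 1 := cfc_le_one _ _ fun x _ => (hs x).2
  have hG₂ : -1 ≤ G := by
    have : algebraMap ℝ (Matrix ι ι ℂ) (-1) ≤ G :=
      algebraMap_le_cfc _ _ _ (fun x _ => (hs x).1) hc
    simpa using this
  have habs : cfc (fun x : ℝ => |x|) (P - Q) = (P - Q) * G := by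
    conv_rhs => enter [1]; rw [← cfc_id' ℝ (P - Q)]
    rw [← cfc_mul _ _ _ (by fun_prop) hc]
    congr 1; ext x
    exact (mul_comm _ _).trans (sign_mul_self x) |>.symm
  rw [traceNorm_eq_trace_cfc_abs hD, habs, sub_mul, trace_sub, Complex.sub_re]
  have e₁ := trace_mul_re_mono hP hG₁
  have e₂ := trace_mul_re_mono hQ hG₂
  simp only [mul_neg, mul_one, trace_neg, Complex.neg_re] at e₁ e₂
  linarith

/-- The trace of a product of functions of two Hermitian matrices, in terms of their spectra. -/
theorem trace_cfc_mul_cfc {A B : Matrix ι ι ℂ} (hA : A.IsHermitian) (hB : B.IsHermitian)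
    (f g : ℝ → ℝ) :
    (cfc f A * cfc g B).trace.re = ∑ i, ∑ j,
      Complex.normSq ((star (hA.eigenvectorUnitary : Matrix ι ι ℂ) *
        (hB.eigenvectorUnitary : Matrix ι ι ℂ)) i j) *
        (f (hA.eigenvalues i) * g (hB.eigenvalues j)) := by
  rw [hA.cfc_eq, hB.cfc_eq, IsHermitian.cfc, IsHermitian.cfc, Unitary.conjStarAlgAut_apply,
    Unitary.conjStarAlgAut_apply]
  set U := (hA.eigenvectorUnitary : Matrix ι ι ℂ)
  set V := (hB.eigenvectorUnitary : Matrix ι ι ℂ)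
  set W := star U * V with hW
  have : (U * diagonal (RCLike.ofReal ∘ f ∘ hA.eigenvalues) * star U *
      (V * diagonal (RCLike.ofReal ∘ g ∘ hB.eigenvalues) * star V)).trace =
      (diagonal (RCLike.ofReal ∘ f ∘ hA.eigenvalues) * W *
        diagonal (RCLike.ofReal ∘ g ∘ hB.eigenvalues) * star W).trace := by
    rw [hW, star_mul, star_star]
    simp only [mul_assoc]
    rw [trace_mul_comm U]
    simp only [mul_assoc]
  erw [this]
  rw [trace, Complex.re_sum]
  refine Finset.sum_congr rfl fun i _ => ?_
  rw [diag_apply, mul_apply, Complex.re_sum]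
  refine Finset.sum_congr rfl fun j _ => ?_
  rw [mul_diagonal, diagonal_mul, star_apply]
  have : ((f (hA.eigenvalues i) : ℂ) * W i j * (g (hB.eigenvalues j) : ℂ) * star (W i j)) =
    ((f (hA.eigenvalues i) * g (hB.eigenvalues j) : ℝ) : ℂ) * (W i j * star (W i j)) := by
    push_cast; ring
  erw [this]
  rw [Complex.re_ofReal_mul, Complex.star_def, Complex.mul_conj, Complex.ofReal_re, mul_comm]

theorem mul_log_sub_mul_log_ge {s w : ℝ} (hs : 0 ≤ s) (hw : 0 < w) :
    s - w ≤ s * Real.log s - s * Real.log w := by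
  rcases hs.eq_or_lt with rfl | hs
  · simpa using hw.le
  have := Real.log_le_sub_one_of_pos (div_pos hw hs)
  rw [Real.log_div hw.ne' hs.ne'] at this
  have h2 := mul_le_mul_of_nonneg_left this hs.le
  rw [mul_sub, mul_sub, mul_div_cancel₀ _ hs.ne'] at h2
  linarith

/-- Klein's inequality for density matrices. -/
theorem vonNeumannEntropy_le {σ ω : Matrix ι ι ℂ} (hσ : σ.PosSemidef) (hω : ω.PosDef)
    (htr : σ.trace = ω.trace) :
    vonNeumannEntropy σ ≤ -(σ * cfc Real.log ω).trace.re := by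
  have hσ' : IsSelfAdjoint σ := hσ.isHermitian
  have hω' : IsSelfAdjoint ω := hω.isHermitian
  have t := fun f g => trace_cfc_mul_cfc hσ.isHermitian hω.isHermitian f g
  -- All four traces are sums with the same nonnegative weights, the squared overlaps of the two
  -- eigenbases. Klein's inequality thus reduces termwise to the scalar inequality
  -- `mul_log_sub_mul_log_ge`.
  have e₁ := t (fun x => x * Real.log x) (fun _ => 1)
  have e₂ := t (fun x => x) Real.log
  have e₃ := t (fun x => x) (fun _ => 1)
  have e₄ := t (fun _ => 1) (fun x => x)
  rw [cfc_mul _ _ _ (by fun_prop) (continuousOn_spectrum_real _ _)] at e₁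
  simp only [cfc_const_one ℝ σ, cfc_const_one ℝ ω, cfc_id' ℝ σ, cfc_id' ℝ ω, one_mul,
    mul_one] at e₁ e₂ e₃ e₄
  rw [vonNeumannEntropy, e₁, e₂, neg_le_neg_iff, ← sub_nonneg]
  have h0 : 0 = σ.trace.re - ω.trace.re := by rw [htr, sub_self]
  rw [h0, e₃, e₄]
  simp only [← Finset.sum_sub_distrib, ← mul_sub (Complex.normSq _)]
  refine Finset.sum_le_sum fun i _ => Finset.sum_le_sum fun j _ =>
    mul_le_mul_of_nonneg_left (mul_log_sub_mul_log_ge (hσ.eigenvalues_nonneg i)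
      (hω.eigenvalues_pos j)) (Complex.normSq_nonneg _)

/-- Operator monotonicity of the logarithm needs a strictly positive lower operator, while ρ may be
singular. So c ρ is first mixed with weight t of m · 1, and then t → 0. -/
theorem neg_trace_mul_log_le_of_smul_le {ρ ω : Matrix ι ι ℂ} (hρ : ρ.PosSemidef)
    (htr : ρ.trace = 1) {c m : ℝ} (hc : 0 < c) (hm : 0 < m) (h : c • ρ ≤ ω) (hω : m • 1 ≤ ω) :
    -(ρ * cfc Real.log ω).trace.re ≤ vonNeumannEntropy ρ - Real.log c := by
  have hρ' : IsSelfAdjoint ρ := hρ.isHermitian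
  have key : ∀ t ∈ Set.Ioo (0 : ℝ) 1,
      vonNeumannEntropy ρ - Real.log ((1 - t) * c) ≥ -(ρ * cfc Real.log ω).trace.re := by
    intro t ht
    have ht' : 0 < 1 - t := by linarith [ht.2]
    set f : ℝ → ℝ := fun x => (1 - t) * c * x + t * m
    have hf : cfc f ρ = (1 - t) • c • ρ + t • m • 1 := by
      rw [cfc_add ρ (fun x => (1 - t) * c * x) (fun _ => t * m),
        cfc_const_mul ((1-t) * c) (fun x : ℝ => x) ρ,
        cfc_id' ℝ ρ, cfc_const _ _, smul_smul, smul_smul, Algebra.algebraMap_eq_smul_one]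
    have hle : cfc f ρ ≤ ω := by
      rw [hf]
      calc _ ≤ (1 - t) • ω + t • ω := add_le_add (smul_le_smul_of_nonneg_left h ht'.le)
            (smul_le_smul_of_nonneg_left hω ht.1.le)
        _ = ω := by rw [← add_smul]; simp
    have hspec : ∀ x ∈ spectrum ℝ ρ, 0 ≤ x := fun x hx => spectrum_nonneg_of_nonneg hρ.nonneg hx
    have hpos : IsStrictlyPositive (cfc f ρ) := by
      rw [cfc_isStrictlyPositive_iff _ _]
      intro x hx
      have := hspec x hx
      have := ht.1
      positivity
    have hlog := CFC.log_le_log hle hpos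
    rw [CFC.log, CFC.log, ← cfc_comp' Real.log f ρ
      (Set.Finite.continuousOn (Matrix.finite_real_spectrum.image _) _)] at hlog
    have h₁ := trace_mul_re_mono hρ.nonneg hlog
    have h₂ : (cfc (fun x : ℝ => x * Real.log x + Real.log ((1 - t) * c) * x) ρ).trace.re ≤
        (ρ * cfc (fun x => Real.log (f x)) ρ).trace.re := by
      have : ρ * cfc (fun x => Real.log (f x)) ρ = cfc (fun x : ℝ => x * Real.log (f x)) ρ := by
        rw [cfc_mul _ _ _ (by fun_prop) (continuousOn_spectrum_real _ _), cfc_id' ℝ ρ]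
      rw [this]
      have hh : cfc (fun x : ℝ => x * Real.log x + Real.log ((1 - t) * c) * x) ρ ≤
          cfc (fun x : ℝ => x * Real.log (f x)) ρ := by
        refine cfc_mono ?_ (continuousOn_spectrum_real _ _) (continuousOn_spectrum_real _ _)
        intro x hx
        -- On the kernel of ρ both sides vanish thanks to the factor x, so `Real.log 0` does no
        -- harm.
        rcases (hspec x hx).eq_or_lt with rfl | h0
        · simp
        rw [mul_comm _ x, ← mul_add]
        refine mul_le_mul_of_nonneg_left ?_ h0.le
        rw [← Real.log_mul h0.ne' (by positivity)]
        refine Real.log_le_log (by positivity) ?_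
        simp only [f]
        nlinarith [mul_pos ht.1 hm]
      have := (Complex.le_def.mp ((tracePositiveLinearMap ι ℂ ℂ).monotone' hh)).1
      simpa using this
    rw [cfc_add _ _ _ (continuousOn_spectrum_real _ _) (continuousOn_spectrum_real _ _),
      cfc_mul _ _ _ (by fun_prop) (continuousOn_spectrum_real _ _), cfc_const_mul _ _ _ (by fun_prop),
      cfc_id' ℝ ρ, trace_add, trace_smul, htr] at h₂
    simp only [Complex.add_re, Complex.smul_re, Complex.one_re, smul_eq_mul, mul_one] at h₂
    rw [vonNeumannEntropy]
    linarith
  have hlim : Filter.Tendsto (fun t : ℝ => vonNeumannEntropy ρ - Real.log ((1 - t) * c))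
      (nhdsWithin 0 (Set.Ioi 0)) (nhds (vonNeumannEntropy ρ - Real.log c)) := by
    have : ContinuousAt (fun t : ℝ => vonNeumannEntropy ρ - Real.log ((1 - t) * c)) 0 := by
      refine continuousAt_const.sub (ContinuousAt.log (by fun_prop) (by simpa using hc.ne'))
    simpa using this.tendsto.mono_left nhdsWithin_le_nhds
  refine ge_of_tendsto hlim ?_
  filter_upwards [Ioo_mem_nhdsGT one_pos] with t ht using key t ht

theorem vonNeumannEntropy_nonneg {ρ : Matrix ι ι ℂ} (hρ : ρ.PosSemidef) (htr : ρ.trace = 1) :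
    0 ≤ vonNeumannEntropy ρ := by
  have hρ' : IsSelfAdjoint ρ := hρ.isHermitian
  have h := hρ.isHermitian.trace_eq_sum_eigenvalues
  rw [htr] at h
  have hsum : ∑ i, hρ.isHermitian.eigenvalues i = 1 := by
    have := congrArg Complex.re h
    simpa using this.symm
  have hle : ∀ i, hρ.isHermitian.eigenvalues i ≤ 1 := fun i =>
    hsum ▸ Finset.single_le_sum (fun j _ => hρ.eigenvalues_nonneg j) (Finset.mem_univ i)
  have hneg : cfc Real.log ρ ≤ 0 := by
    refine cfc_nonpos _ _ fun x hx => ?_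
    rw [hρ.isHermitian.spectrum_real_eq_range_eigenvalues] at hx
    obtain ⟨i, rfl⟩ := hx
    exact Real.log_nonpos (hρ.eigenvalues_nonneg i) (hle i)
  have := trace_mul_re_mono hρ.nonneg hneg
  rw [vonNeumannEntropy]
  simpa using this

theorem vonNeumannEntropy_le_log_card {ρ : Matrix ι ι ℂ} (hρ : ρ.PosSemidef)
    (htr : ρ.trace = 1) : vonNeumannEntropy ρ ≤ Real.log (Fintype.card ι) := by
  have hne : Nonempty ι := by
    by_contra h
    rw [not_nonempty_iff] at h
    simp [trace] at htr
  have hc : (0 : ℝ) < Fintype.card ι := by exact_mod_cast Fintype.card_pos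
  set r : ℝ := (Fintype.card ι : ℝ)⁻¹
  have hω : (algebraMap ℝ (Matrix ι ι ℂ) r).PosDef := by
    rw [Algebra.algebraMap_eq_smul_one]
    exact PosDef.one.smul (inv_pos.mpr hc)
  have h := vonNeumannEntropy_le hρ hω (by
    rw [htr, Algebra.algebraMap_eq_smul_one, trace_smul, trace_one]
    simp [r])
  rw [cfc_algebraMap, Algebra.algebraMap_eq_smul_one, mul_smul_comm, mul_one, trace_smul, htr] at h
  simpa [r, Real.log_inv, -Complex.natCast_log] using h

theorem cfc_log_sub_mem {ω Y : Matrix ι ι ℂ} (hY : Y.PosDef) {a b : ℝ} (ha : 0 < a) (hb : 0 < b)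
    (h₁ : a • Y ≤ ω) (h₂ : ω ≤ b • Y) :
    Real.log a • 1 + cfc Real.log Y ≤ cfc Real.log ω ∧
      cfc Real.log ω ≤ Real.log b • 1 + cfc Real.log Y := by
  have hY' := hY.isStrictlyPositive
  have haY : IsStrictlyPositive (a • Y) := (hY.smul ha).isStrictlyPositive
  have hωp : IsStrictlyPositive ω := haY.of_le h₁
  have e₁ := CFC.log_le_log h₁ haY
  have e₂ := CFC.log_le_log h₂ hωp
  rw [CFC.log_smul' Y ha hY', Algebra.algebraMap_eq_smul_one] at e₁
  rw [CFC.log_smul' Y hb hY', Algebra.algebraMap_eq_smul_one] at e₂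
  exact ⟨e₁, e₂⟩

end Matrix

/-! ### Operators acting trivially at one site, and depolarizing channels. -/

section Sites
variable {Λ : Type*} [Fintype Λ] [DecidableEq Λ] {q : ℕ}

open scoped Kronecker in
/-- The embedding `T ↦ 1 ⊗ T` of the operators on `Λ \ {x}` into the operators on `Λ`. -/
noncomputable def siteEmbed (x : Λ) : SpinOp {y : Λ // y ≠ x} q →⋆ₐ[ℂ] SpinOp Λ q where
  toFun T := ((1 : Matrix (Fin q) (Fin q) ℂ) ⊗ₖ T).submatrix
    (Equiv.funSplitAt x (Fin q)) (Equiv.funSplitAt x (Fin q))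
  map_one' := by simp
  map_mul' S T := by
    rw [Matrix.submatrix_mul_equiv, ← Matrix.mul_kronecker_mul, one_mul]
  map_zero' := by simp
  map_add' S T := by rw [Matrix.kronecker_add]; rfl
  commutes' r := by
    rw [Algebra.algebraMap_eq_smul_one, Algebra.algebraMap_eq_smul_one, Matrix.kronecker_smul]
    simp [Matrix.submatrix_smul]
  map_star' T := by
    simp [Matrix.star_eq_conjTranspose, Matrix.conjTranspose_kronecker]

theorem siteEmbed_apply (x : Λ) (T : SpinOp {y : Λ // y ≠ x} q) (i j : SpinConfig Λ q) :
    siteEmbed x T i j = if i x = j x then T (fun y => i y) (fun y => j y) else 0 := by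
  change (Matrix.kronecker 1 T) _ _ = _
  rw [Matrix.kronecker, Matrix.kroneckerMap_apply, Matrix.one_apply]
  simp [Equiv.funSplitAt]

theorem continuous_siteEmbed (x : Λ) : Continuous (siteEmbed (q := q) x) :=
  LinearMap.continuous_of_finiteDimensional (siteEmbed (q := q) x).toAlgHom.toLinearMap

/-- The partial trace is the adjoint of T ↦ 1 ⊗ T. This is how the condition Tr_x D = 0 enters the
proof. -/
theorem trace_mul_siteEmbed (x : Λ) (D : SpinOp Λ q) (T : SpinOp {y : Λ // y ≠ x} q) :
    (D * siteEmbed x T).trace = (partialTraceSite x D * T).trace := by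
  set e := Equiv.funSplitAt x (Fin q)
  have h₁ : (D * siteEmbed x T).trace =
      ∑ a, ∑ i, ∑ b, ∑ j, D (e.symm (a, i)) (e.symm (b, j)) *
        (if b = a then T j i else 0) := by
    rw [Matrix.trace, ← e.symm.sum_comp, Fintype.sum_prod_type]
    refine Finset.sum_congr rfl fun a _ => Finset.sum_congr rfl fun i _ => ?_
    rw [Matrix.diag_apply, Matrix.mul_apply, ← e.symm.sum_comp, Fintype.sum_prod_type]
    refine Finset.sum_congr rfl fun b _ => Finset.sum_congr rfl fun j _ => ?_
    congr 1
    change (Matrix.kronecker 1 T) (e (e.symm (b, j))) (e (e.symm (a, i))) = _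
    rw [Matrix.kronecker, Matrix.kroneckerMap_apply, Matrix.one_apply]
    simp
  rw [h₁, Matrix.trace, Finset.sum_comm]
  refine Finset.sum_congr rfl fun i _ => ?_
  rw [Matrix.diag_apply, Matrix.mul_apply]
  simp only [partialTraceSite, Matrix.of_apply, Finset.sum_mul]
  rw [Finset.sum_comm (s := (Finset.univ : Finset ({y // y ≠ x} → Fin q)))]
  refine Finset.sum_congr rfl fun a _ => ?_
  rw [Finset.sum_comm]
  refine Finset.sum_congr rfl fun j _ => ?_
  simp [e]

/-- The channel replacing the spin at `x` by the maximally mixed one. -/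
noncomputable def siteAverage (x : Λ) : SpinOp Λ q →ₗ[ℝ] SpinOp Λ q where
  toFun X := Matrix.of fun i j => if i x = j x then
    (q : ℂ)⁻¹ * ∑ a, X (Function.update i x a) (Function.update j x a) else 0
  map_add' X Y := by
    ext i j
    by_cases h : i x = j x <;> simp [h, Finset.sum_add_distrib, mul_add]
  map_smul' r X := by
    ext i j
    by_cases h : i x = j x <;> simp [h, Finset.mul_sum, mul_left_comm]

omit [Fintype Λ] in
theorem siteAverage_apply (x : Λ) (X : SpinOp Λ q) (i j : SpinConfig Λ q) :
    siteAverage x X i j = if i x = j x then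
      (q : ℂ)⁻¹ * ∑ a, X (Function.update i x a) (Function.update j x a) else 0 := rfl

omit [Fintype Λ] in
theorem funSplitAt_symm_restrict (x : Λ) (a : Fin q) (i : SpinConfig Λ q) :
    (Equiv.funSplitAt x (Fin q)).symm (a, fun y => i y) = Function.update i x a := by
  ext y
  by_cases h : y = x
  · subst h; simp [Equiv.funSplitAt]
  · simp [Equiv.funSplitAt, Equiv.piSplitAt, h]

theorem siteAverage_eq_siteEmbed (x : Λ) (X : SpinOp Λ q) :
    siteAverage x X = siteEmbed x ((q : ℝ)⁻¹ • partialTraceSite x X) := by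
  ext i j
  rw [siteAverage_apply, siteEmbed_apply]
  simp [partialTraceSite, funSplitAt_symm_restrict]

omit [Fintype Λ] in
theorem partialTraceSite_isHermitian (x : Λ) {X : SpinOp Λ q} (hX : X.IsHermitian) :
    (partialTraceSite x X).IsHermitian := by
  ext i j
  simp [partialTraceSite, hX.apply]

omit [Fintype Λ] in
theorem siteAverage_comm (x y : Λ) (X : SpinOp Λ q) :
    siteAverage x (siteAverage y X) = siteAverage y (siteAverage x X) := by
  rcases eq_or_ne x y with rfl | h
  · rfl
  ext i j
  simp only [siteAverage_apply, Function.update_of_ne h, Function.update_of_ne h.symm]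
  by_cases h₁ : i x = j x <;> by_cases h₂ : i y = j y <;> simp only [h₁, h₂, if_true, if_false,
    Finset.sum_const_zero, mul_zero]
  rw [← Finset.mul_sum, ← Finset.mul_sum, Finset.sum_comm]
  simp only [Function.update_comm h]

theorem trace_siteAverage (x : Λ) (hq : 1 ≤ q) (X : SpinOp Λ q) :
    (siteAverage x X).trace = X.trace := by
  have hq0 : (q : ℂ) ≠ 0 := by exact_mod_cast (by omega : q ≠ 0)
  simp only [Matrix.trace, Matrix.diag_apply, siteAverage_apply, if_true]
  rw [← Finset.mul_sum, ← (Equiv.funSplitAt x (Fin q)).symm.sum_comp,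
    ← (Equiv.funSplitAt x (Fin q)).symm.sum_comp, Fintype.sum_prod_type, Fintype.sum_prod_type]
  have : ∀ (b : Fin q) (i : {y // y ≠ x} → Fin q) (a : Fin q),
      Function.update ((Equiv.funSplitAt x (Fin q)).symm (b, i)) x a =
        (Equiv.funSplitAt x (Fin q)).symm (a, i) := by
    intro b i a
    rw [← funSplitAt_symm_restrict]
    congr 2
    ext y
    simp [Equiv.funSplitAt, Equiv.piSplitAt, y.2]
  simp only [this]
  rw [Finset.sum_const, Finset.card_univ, Fintype.card_fin, nsmul_eq_mul,
    inv_mul_cancel_left₀ hq0, Finset.sum_comm]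

/-- By the Schur product theorem: the pattern [i x = j x] is a positive semidefinite matrix. -/
theorem siteAverage_nonneg (x : Λ) {X : SpinOp Λ q} (hX : 0 ≤ X) : 0 ≤ siteAverage x X := by
  have hX' := Matrix.nonneg_iff_posSemidef.mp hX
  have : siteAverage x X = (q : ℝ)⁻¹ • ∑ a, Matrix.hadamard
      (X.submatrix (fun i => Function.update i x a) fun i => Function.update i x a)
      ((1 : Matrix (Fin q) (Fin q) ℂ).submatrix (fun i : SpinConfig Λ q => i x) fun i => i x) := by
    ext i j
    rw [siteAverage_apply]
    simp only [Matrix.smul_apply, Matrix.sum_apply, Matrix.hadamard_apply, Matrix.submatrix_apply,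
      Matrix.one_apply]
    by_cases h : i x = j x <;> simp [h]
  rw [this]
  exact smul_nonneg (by positivity) (Finset.sum_nonneg fun a _ =>
    ((hX'.submatrix _).hadamard (Matrix.PosSemidef.one.submatrix _)).nonneg)

theorem posSemidef_card_sub_ones (q : ℕ) :
    ((q : ℂ) • (1 : Matrix (Fin q) (Fin q) ℂ) - Matrix.of fun _ _ => 1).PosSemidef := by
  rcases Nat.eq_zero_or_pos q with rfl | hq
  · rw [Subsingleton.elim (_ - _ : Matrix (Fin 0) (Fin 0) ℂ) 0]
    exact .zero
  set J : Matrix (Fin q) (Fin q) ℂ := Matrix.of fun _ _ => 1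
  set B := (q : ℂ) • (1 : Matrix (Fin q) (Fin q) ℂ) - J
  have hq0 : (q : ℝ) ≠ 0 := by exact_mod_cast hq.ne'
  have hJ : J * J = (q : ℂ) • J := by
    ext i j; simp [J, Matrix.mul_apply]
  have hB : B.conjTranspose = B := by
    have : J.conjTranspose = J := by ext; simp [J]
    simp [B, this]
  -- Here B is q times the projection orthogonal to the all-ones vector.
  have hBB : B.conjTranspose * B = (q : ℝ) • B := by
    rw [hB]
    simp only [B, sub_mul, mul_sub, hJ]
    ext i j; simp; ring
  have : B = (q : ℝ)⁻¹ • (B.conjTranspose * B) := by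
    rw [hBB, smul_smul, inv_mul_cancel₀ hq0, one_smul]
  rw [this]
  exact (Matrix.posSemidef_conjTranspose_mul_self B).smul (by positivity)

/-- One factor q cancels the normalization of the average, whose term with a = i x is then X
restricted to i x = j x. The other factor restores the entries off that restriction, since the
all-ones matrix is at most q · 1. Both remainders are positive by the Schur product theorem. -/
theorem le_smul_siteAverage (x : Λ) (hq : 1 ≤ q) {X : SpinOp Λ q} (hX : 0 ≤ X) :
    X ≤ (q : ℝ) ^ 2 • siteAverage x X := by
  have hX' := Matrix.nonneg_iff_posSemidef.mp hX
  have hq0 : (q : ℂ) ≠ 0 := by exact_mod_cast (by omega : q ≠ 0)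
  have : (q : ℝ) ^ 2 • siteAverage x X = X +
      ((q : ℝ) • ∑ a, Matrix.hadamard
        (X.submatrix (fun i => Function.update i x a) fun i => Function.update i x a)
        ((Matrix.diagonal fun b : Fin q => if b = a then (0 : ℂ) else 1).submatrix
          (fun i : SpinConfig Λ q => i x) fun i => i x) +
      Matrix.hadamard X (((q : ℂ) • (1 : Matrix (Fin q) (Fin q) ℂ) - Matrix.of fun _ _ => 1).submatrix
          (fun i : SpinConfig Λ q => i x) fun i => i x)) := by
    ext i j
    simp only [Matrix.smul_apply, siteAverage_apply, Matrix.add_apply, Matrix.sum_apply,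
      Matrix.hadamard_apply, Matrix.submatrix_apply, Matrix.sub_apply, Matrix.one_apply,
      Matrix.diagonal_apply, Matrix.of_apply]
    by_cases h : i x = j x
    · have hs : ∑ a, X (Function.update i x a) (Function.update j x a) =
          (∑ a, X (Function.update i x a) (Function.update j x a) *
            (if j x = a then (0 : ℂ) else 1)) + X i j := by
        have : X i j = ∑ a, X (Function.update i x a) (Function.update j x a) *
            (if j x = a then (1 : ℂ) else 0) := by
          simp only [mul_ite, mul_one, mul_zero, Finset.sum_ite_eq, Finset.mem_univ, if_true]
          rw [Function.update_eq_self, ← h, Function.update_eq_self]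
        rw [this, ← Finset.sum_add_distrib]
        refine Finset.sum_congr rfl fun a _ => ?_
        split_ifs <;> simp
      simp only [h, if_true, hs]
      simp only [Complex.real_smul, smul_eq_mul]
      push_cast
      field_simp
      ring
    · simp [h]
  rw [this]
  refine le_add_of_nonneg_right (add_nonneg (smul_nonneg (by positivity)
    (Finset.sum_nonneg fun a _ => ((hX'.submatrix _).hadamard
      (Matrix.PosSemidef.submatrix (Matrix.PosSemidef.diagonal ?_) _)).nonneg))
    (hX'.hadamard ((posSemidef_card_sub_ones q).submatrix _)).nonneg)
  intro b
  dsimp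
  split_ifs <;> simp

/-- Functional calculus commutes with star homomorphisms, so the logarithm of 1 ⊗ T is 1 ⊗ ln T,
which pairs to zero with D. -/
theorem trace_mul_log_siteAverage {x : Λ} {D Z : SpinOp Λ q} (hD : partialTraceSite x D = 0)
    (hZ : 0 ≤ Z) : (D * cfc Real.log (siteAverage x Z)).trace = 0 := by
  have hT : IsSelfAdjoint ((q : ℝ)⁻¹ • partialTraceSite x Z) :=
    (IsSelfAdjoint.all _).smul
      (partialTraceSite_isHermitian x (Matrix.nonneg_iff_posSemidef.mp hZ).isHermitian)
  rw [siteAverage_eq_siteEmbed, ← StarAlgHom.map_cfc (siteEmbed x) Real.log _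
    (Matrix.continuousOn_spectrum_real _ _) (continuous_siteEmbed x) hT (hT.map (siteEmbed x)),
    trace_mul_siteEmbed, hD, zero_mul, Matrix.trace_zero]

/-- The depolarizing channel of strength `s` on the spin at `x`. -/
noncomputable def depolarize (s : ℝ) (x : Λ) : SpinOp Λ q →ₗ[ℝ] SpinOp Λ q :=
  (1 - s) • LinearMap.id + s • siteAverage x

omit [Fintype Λ] in
theorem depolarize_apply (s : ℝ) (x : Λ) (X : SpinOp Λ q) :
    depolarize s x X = (1 - s) • X + s • siteAverage x X := rfl

/-! ### Operator-order bounds for a single depolarizing channel. -/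

section Bounds
variable {s : ℝ} (hs₀ : 0 ≤ s) (hs₁ : s ≤ 1) (x : Λ)
include hs₀ hs₁

theorem depolarize_nonneg {X : SpinOp Λ q} (hX : 0 ≤ X) : 0 ≤ depolarize s x X :=
  add_nonneg (smul_nonneg (sub_nonneg.mpr hs₁) hX) (smul_nonneg hs₀ (siteAverage_nonneg x hX))

theorem depolarize_mono {X Y : SpinOp Λ q} (h : X ≤ Y) : depolarize s x X ≤ depolarize s x Y := by
  have := depolarize_nonneg hs₀ hs₁ x (sub_nonneg.mpr h)
  rwa [map_sub, sub_nonneg] at this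

omit hs₁ in
theorem smul_le_depolarize (hq : 1 ≤ q) {X : SpinOp Λ q} (hX : 0 ≤ X) :
    (1 - s + s / (q : ℝ) ^ 2) • X ≤ depolarize s x X := by
  have hq0 : (q : ℝ) ≠ 0 := by exact_mod_cast (by omega : q ≠ 0)
  rw [depolarize_apply, add_smul]
  refine add_le_add le_rfl ?_
  have := smul_le_smul_of_nonneg_left (le_smul_siteAverage x hq hX)
    (by positivity : 0 ≤ s / (q : ℝ) ^ 2)
  rwa [smul_smul, div_mul_cancel₀ _ (pow_ne_zero 2 hq0)] at this

omit hs₀ in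
theorem smul_siteAverage_le_depolarize {X : SpinOp Λ q} (hX : 0 ≤ X) :
    s • siteAverage x X ≤ depolarize s x X :=
  le_add_of_nonneg_left (smul_nonneg (sub_nonneg.mpr hs₁) hX)

omit hs₀ in
theorem depolarize_le_smul_siteAverage (hq : 1 ≤ q) {X : SpinOp Λ q} (hX : 0 ≤ X) :
    depolarize s x X ≤ ((1 - s) * (q : ℝ) ^ 2 + s) • siteAverage x X := by
  rw [depolarize_apply, add_smul, mul_smul]
  exact add_le_add (smul_le_smul_of_nonneg_left (le_smul_siteAverage x hq hX) (by linarith)) le_rfl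

end Bounds

/-- The composition of the depolarizing channels at the sites of a list. -/
noncomputable def depolarizeList (s : ℝ) (l : List Λ) (X : SpinOp Λ q) : SpinOp Λ q :=
  l.foldr (fun x => depolarize s x) X

theorem trace_depolarizeList (hq : 1 ≤ q) (s : ℝ) (l : List Λ) (X : SpinOp Λ q) :
    (depolarizeList s l X).trace = X.trace := by
  induction l with
  | nil => rfl
  | cons y l ih =>
    change (depolarize s y (depolarizeList s l X)).trace = _
    rw [depolarize_apply, Matrix.trace_add, Matrix.trace_smul, Matrix.trace_smul,
      trace_siteAverage y hq, ih, ← add_smul]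
    simp

theorem depolarizeList_nonneg {s : ℝ} (hs₀ : 0 ≤ s) (hs₁ : s ≤ 1) (l : List Λ) {X : SpinOp Λ q}
    (hX : 0 ≤ X) : 0 ≤ depolarizeList s l X := by
  induction l with
  | nil => exact hX
  | cons y l ih => exact depolarize_nonneg hs₀ hs₁ y ih

theorem smul_le_depolarizeList (hq : 1 ≤ q) {s : ℝ} (hs₀ : 0 ≤ s) (hs₁ : s ≤ 1) (l : List Λ)
    {X : SpinOp Λ q} (hX : 0 ≤ X) :
    (1 - s + s / (q : ℝ) ^ 2) ^ l.length • X ≤ depolarizeList s l X := by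
  induction l with
  | nil => simp [depolarizeList]
  | cons y l ih =>
    rw [List.length_cons, pow_succ', mul_smul]
    have hc : 0 ≤ 1 - s + s / (q : ℝ) ^ 2 := add_nonneg (by linarith) (by positivity)
    exact (smul_le_smul_of_nonneg_left ih hc).trans
      (smul_le_depolarize hs₀ y hq (depolarizeList_nonneg hs₀ hs₁ l hX))

/-- Isolate one channel at x and bound it on both sides by the full average at x. The channels
applied after it preserve order and commute with that average, so they are absorbed into Z. -/
theorem depolarizeList_between (hq : 1 ≤ q) {s : ℝ} (hs₀ : 0 ≤ s) (hs₁ : s ≤ 1) {l : List Λ}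
    {x : Λ} (hx : x ∈ l) {X : SpinOp Λ q} (hX : 0 ≤ X) :
    ∃ Z : SpinOp Λ q, 0 ≤ Z ∧ s • siteAverage x Z ≤ depolarizeList s l X ∧
      depolarizeList s l X ≤ ((1 - s) * (q : ℝ) ^ 2 + s) • siteAverage x Z := by
  induction l with
  | nil => simp at hx
  | cons y l ih =>
    rcases eq_or_ne x y with rfl | hne
    · have := depolarizeList_nonneg hs₀ hs₁ l hX
      exact ⟨_, this, smul_siteAverage_le_depolarize hs₁ x this,
        depolarize_le_smul_siteAverage hs₁ x hq this⟩
    · obtain ⟨Z, hZ, h₁, h₂⟩ := ih ((List.mem_cons.mp hx).resolve_left hne)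
      have hcomm : depolarize s y (siteAverage x Z) = siteAverage x (depolarize s y Z) := by
        simp only [depolarize_apply, map_add, map_smul, siteAverage_comm y x]
      refine ⟨depolarize s y Z, depolarize_nonneg hs₀ hs₁ y hZ, ?_, ?_⟩
      · have := depolarize_mono hs₀ hs₁ y h₁
        rwa [map_smul, hcomm] at this
      · have := depolarize_mono hs₀ hs₁ y h₂
        rwa [map_smul, hcomm] at this

theorem trace_mul_log_depolarizeList_le (hq : 1 ≤ q) {s : ℝ} (hs₀ : 0 < s) (hs₁ : s ≤ 1)
    {l : List Λ} {x : Λ} (hx : x ∈ l) {X : SpinOp Λ q} (hX : 0 ≤ X)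
    (hω : (depolarizeList s l X).PosDef) {D : SpinOp Λ q} (hD : IsTracelessSelfAdjoint D)
    (hDx : partialTraceSite x D = 0) :
    (D * cfc Real.log (depolarizeList s l X)).trace.re ≤
      1 / 2 * Real.log (((1 - s) * (q : ℝ) ^ 2 + s) / s) * traceNorm D := by
  obtain ⟨Z, hZ, h₁, h₂⟩ := depolarizeList_between hq hs₀.le hs₁ hx hX
  set ω := depolarizeList s l X
  set Y := siteAverage x Z
  set b := (1 - s) * (q : ℝ) ^ 2 + s
  have hb : 0 < b := add_pos_of_nonneg_of_pos (mul_nonneg (by linarith) (by positivity)) hs₀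
  have hY : Y.PosDef := by
    have hbY : (b • Y).PosDef :=
      Matrix.isStrictlyPositive_iff_posDef.mp (hω.isStrictlyPositive.of_le h₂)
    have := hbY.smul (inv_pos.mpr hb)
    rwa [smul_smul, inv_mul_cancel₀ hb.ne', one_smul] at this
  obtain ⟨e₁, e₂⟩ := Matrix.cfc_log_sub_mem hY hs₀ hb h₁ h₂
  -- The midpoint of the interval: as D is traceless, subtracting m · 1 is free, and centring
  -- produces the factor 1/2.
  set m := (Real.log s + Real.log b) / 2
  set G := cfc Real.log ω - cfc Real.log Y - m • 1
  have hg : 1 / 2 * Real.log (b / s) = Real.log b - m := by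
    rw [Real.log_div hb.ne' hs₀.ne']; ring
  have hg' : -(1 / 2 * Real.log (b / s)) = Real.log s - m := by
    rw [Real.log_div hb.ne' hs₀.ne']; ring
  have hDG : (D * G).trace = (D * cfc Real.log ω).trace := by
    simp only [G, mul_sub, Matrix.trace_sub, Y, trace_mul_log_siteAverage hDx hZ, mul_smul_comm,
      mul_one, Matrix.trace_smul, hD.trace_eq_zero, smul_zero, sub_zero]
  rw [← hDG]
  refine Matrix.trace_mul_re_le_traceNorm hD.isHermitian ?_ ?_
  · rw [← neg_smul, hg', sub_smul]
    exact sub_le_sub_right (le_sub_iff_add_le.mpr e₁) _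
  · rw [hg, sub_smul]
    exact sub_le_sub_right (sub_le_iff_le_add.mpr e₂) _

theorem entropy_sub_le_of_decomposition (hq : 1 ≤ q) {ρ σ : SpinOp Λ q} (hρ : IsQuantumState ρ)
    (hσ : IsQuantumState σ) {D : Λ → SpinOp Λ q} (hD : IsW1Decomposition (ρ - σ) D) {s : ℝ}
    (hs₀ : 0 < s) (hs₁ : s ≤ 1) :
    vonNeumannEntropy σ - vonNeumannEntropy ρ ≤
      -(Fintype.card Λ * Real.log (1 - s + s / (q : ℝ) ^ 2)) +
        1 / 2 * Real.log (((1 - s) * (q : ℝ) ^ 2 + s) / s) * ∑ x, traceNorm (D x) := by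
  have hq0 : (0 : ℝ) < q := by exact_mod_cast hq
  set c := 1 - s + s / (q : ℝ) ^ 2
  have hc : 0 < c := add_pos_of_nonneg_of_pos (by linarith) (by positivity)
  have : Nonempty (Fin q) := ⟨⟨0, hq⟩⟩
  have hcard : (0 : ℝ) < Fintype.card (SpinConfig Λ q) := by exact_mod_cast Fintype.card_pos
  set r : ℝ := (Fintype.card (SpinConfig Λ q) : ℝ)⁻¹
  have hr : 0 < r := inv_pos.mpr hcard
  have key : ∀ δ ∈ Set.Ioo (0 : ℝ) 1, vonNeumannEntropy σ - vonNeumannEntropy ρ ≤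
      -Real.log (c ^ Fintype.card Λ * (1 - δ)) +
        1 / 2 * Real.log (((1 - s) * (q : ℝ) ^ 2 + s) / s) * ∑ x, traceNorm (D x) := by
    intro δ hδ
    have hδ' : 0 < 1 - δ := by linarith [hδ.2]
    set l := (Finset.univ : Finset Λ).toList
    have hl : l.length = Fintype.card Λ := by simp [l]
    -- A fraction δ of the maximally mixed state makes ω positive definite without changing the
    -- trace; it is removed by δ → 0.
    set X : SpinOp Λ q := (1 - δ) • ρ + (δ * r) • 1
    have h1 : (1 - δ) • ρ ≤ X :=
      le_add_of_nonneg_right (smul_nonneg (mul_pos hδ.1 hr).le zero_le_one)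
    have h2 : (δ * r) • 1 ≤ X :=
      le_add_of_nonneg_left (smul_nonneg hδ'.le hρ.posSemidef.nonneg)
    have hX : 0 ≤ X := (smul_nonneg (mul_pos hδ.1 hr).le zero_le_one).trans h2
    have hXt : X.trace = 1 := by
      have : (δ * r * Fintype.card (SpinConfig Λ q) : ℝ) = δ := by
        rw [mul_assoc, inv_mul_cancel₀ hcard.ne', mul_one]
      have h3 : ((δ * r * Fintype.card (SpinConfig Λ q) : ℝ) : ℂ) = δ := by rw [this]
      rw [Complex.ofReal_mul, Complex.ofReal_natCast] at h3
      rw [Matrix.trace_add, Matrix.trace_smul, Matrix.trace_smul, hρ.trace_eq_one,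
        Matrix.trace_one, Complex.real_smul, Complex.real_smul, h3]
      push_cast; ring
    set ω := depolarizeList s l X
    have hωX : c ^ Fintype.card Λ • X ≤ ω := by
      rw [← hl]; exact smul_le_depolarizeList hq hs₀.le hs₁ l hX
    have hcn : 0 < c ^ Fintype.card Λ := pow_pos hc _
    have h3 : (c ^ Fintype.card Λ * (1 - δ)) • ρ ≤ ω := by
      rw [mul_smul]; exact (smul_le_smul_of_nonneg_left h1 hcn.le).trans hωX
    have h4 : (c ^ Fintype.card Λ * (δ * r)) • 1 ≤ ω := by
      rw [mul_smul]; exact (smul_le_smul_of_nonneg_left h2 hcn.le).trans hωX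
    have hm : 0 < c ^ Fintype.card Λ * (δ * r) := mul_pos hcn (mul_pos hδ.1 hr)
    have hω : ω.PosDef :=
      Matrix.isStrictlyPositive_iff_posDef.mp
        ((Matrix.PosDef.one.smul hm).isStrictlyPositive.of_le h4)
    have hωt : ω.trace = 1 := (trace_depolarizeList hq s l X).trans hXt
    have k1 := Matrix.vonNeumannEntropy_le hσ.posSemidef hω (hσ.trace_eq_one.trans hωt.symm)
    have k2 := Matrix.neg_trace_mul_log_le_of_smul_le hρ.posSemidef hρ.trace_eq_one
      (mul_pos hcn hδ') hm h3 h4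
    have k3 : ((ρ - σ) * cfc Real.log ω).trace.re ≤
        1 / 2 * Real.log (((1 - s) * (q : ℝ) ^ 2 + s) / s) * ∑ x, traceNorm (D x) := by
      rw [← hD.sum_eq, Finset.sum_mul, Matrix.trace_sum, Complex.re_sum, Finset.mul_sum]
      exact Finset.sum_le_sum fun x _ => trace_mul_log_depolarizeList_le hq hs₀ hs₁
        (by simp [l]) hX hω (hD.traceless x) (hD.partialTrace_eq_zero x)
    rw [sub_mul, Matrix.trace_sub, Complex.sub_re] at k3
    linarith
  have hlim : Filter.Tendsto (fun δ : ℝ => -Real.log (c ^ Fintype.card Λ * (1 - δ)) +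
        1 / 2 * Real.log (((1 - s) * (q : ℝ) ^ 2 + s) / s) * ∑ x, traceNorm (D x))
      (nhdsWithin 0 (Set.Ioi 0)) (nhds (-(Fintype.card Λ * Real.log c) +
        1 / 2 * Real.log (((1 - s) * (q : ℝ) ^ 2 + s) / s) * ∑ x, traceNorm (D x))) := by
    have : ContinuousAt (fun δ : ℝ => -Real.log (c ^ Fintype.card Λ * (1 - δ)) +
        1 / 2 * Real.log (((1 - s) * (q : ℝ) ^ 2 + s) / s) * ∑ x, traceNorm (D x)) 0 := by
      refine (ContinuousAt.log (by fun_prop) ?_).neg.add continuousAt_const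
      simpa using fun h => absurd h hc.ne'
    simpa [Real.log_pow] using this.tendsto.mono_left nhdsWithin_le_nhds
  refine ge_of_tendsto hlim ?_
  filter_upwards [Ioo_mem_nhdsGT one_pos] with t ht using key t ht

end Sites

/-! ### Hybrid product states and basic properties of the W₁ norm. -/

section Hybrid
variable {Λ : Type*} [Fintype Λ] [DecidableEq Λ] {q : ℕ}

theorem trace_partialTraceSite (x : Λ) (X : SpinOp Λ q) :
    (partialTraceSite x X).trace = X.trace := by
  have := trace_mul_siteEmbed x X 1
  rwa [map_one, mul_one, mul_one, eq_comm] at this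

/-- The tensor product of the marginal of `σ` on `A` with the marginal of `ρ` on the complement
of `A`. -/
noncomputable def hybridState (ρ σ : SpinOp Λ q) (A : Finset Λ) : SpinOp Λ q :=
  (Fintype.card (SpinConfig Λ q) : ℝ)⁻¹ • Matrix.hadamard
    (∑ c : SpinConfig Λ q, σ.submatrix (fun i => A.piecewise i c) fun i => A.piecewise i c)
    (∑ d : SpinConfig Λ q, ρ.submatrix (fun i => A.piecewise d i) fun i => A.piecewise d i)

/-- The sums run over full configurations although c matters only off A and d only on A. The
overcount is q^|A| · q^(n-|A|), exactly the number of configurations, which the prefactor cancels.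
-/
theorem hybridState_apply (ρ σ : SpinOp Λ q) (A : Finset Λ) (i j : SpinConfig Λ q) :
    hybridState ρ σ A i j = (Fintype.card (SpinConfig Λ q) : ℂ)⁻¹ *
      ∑ p : SpinConfig Λ q × SpinConfig Λ q,
        σ (A.piecewise i p.1) (A.piecewise j p.1) * ρ (A.piecewise p.2 i) (A.piecewise p.2 j) := by
  rw [Fintype.sum_prod_type]
  simp [hybridState, Matrix.sum_apply, Finset.sum_mul_sum]

theorem hybridState_nonneg {ρ σ : SpinOp Λ q} (hρ : 0 ≤ ρ) (hσ : 0 ≤ σ) (A : Finset Λ) :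
    0 ≤ hybridState ρ σ A := by
  have hρ' := Matrix.nonneg_iff_posSemidef.mp hρ
  have hσ' := Matrix.nonneg_iff_posSemidef.mp hσ
  exact smul_nonneg (by positivity) (Matrix.PosSemidef.hadamard
    (Matrix.posSemidef_sum _ fun _ _ => hσ'.submatrix _)
    (Matrix.posSemidef_sum _ fun _ _ => hρ'.submatrix _)).nonneg

theorem hybridState_empty {ρ σ : SpinOp Λ q} (hq : 1 ≤ q) (hσ : σ.trace = 1) :
    hybridState ρ σ ∅ = ρ := by
  have : Nonempty (Fin q) := ⟨⟨0, hq⟩⟩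
  have hc : (Fintype.card (SpinConfig Λ q) : ℂ) ≠ 0 := by exact_mod_cast Fintype.card_ne_zero
  have hσ' : ∑ c, σ c c = 1 := hσ
  ext i j
  rw [hybridState_apply, Fintype.sum_prod_type]
  simp only [Finset.piecewise_empty, Finset.sum_const, Finset.card_univ, nsmul_eq_mul]
  rw [← Finset.mul_sum, ← Finset.sum_mul, hσ', one_mul, inv_mul_cancel_left₀ hc]

theorem hybridState_univ {ρ σ : SpinOp Λ q} (hq : 1 ≤ q) (hρ : ρ.trace = 1) :
    hybridState ρ σ Finset.univ = σ := by
  have : Nonempty (Fin q) := ⟨⟨0, hq⟩⟩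
  have hc : (Fintype.card (SpinConfig Λ q) : ℂ) ≠ 0 := by exact_mod_cast Fintype.card_ne_zero
  have hρ' : ∑ c, ρ c c = 1 := hρ
  ext i j
  rw [hybridState_apply, Fintype.sum_prod_type]
  simp only [Finset.piecewise_univ, ← Finset.mul_sum, hρ', mul_one, Finset.sum_const,
    Finset.card_univ, nsmul_eq_mul]
  rw [inv_mul_cancel_left₀ hc]

theorem partialTraceSite_hybridState_insert (ρ σ : SpinOp Λ q) {A : Finset Λ} {x : Λ}
    (hx : x ∉ A) :
    partialTraceSite x (hybridState ρ σ (insert x A)) =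
      partialTraceSite x (hybridState ρ σ A) := by
  ext i j
  simp only [partialTraceSite, Matrix.of_apply, hybridState_apply]
  rw [← Finset.mul_sum, ← Finset.mul_sum]
  congr 1
  rw [← Fintype.sum_prod_type', ← Fintype.sum_prod_type']
  set e := Equiv.funSplitAt x (Fin q)
  have ex : ∀ a k, e.symm (a, k) x = a := fun a k => by simp [e, Equiv.funSplitAt]
  have ey : ∀ a b k y, y ≠ x → e.symm (a, k) y = e.symm (b, k) y := fun a b k y h => by
    simp [e, Equiv.funSplitAt, Equiv.piSplitAt, h]
  -- Cyclic permutation of the three letters at x: the traced one, that of c and that of d.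
  -- Afterwards the letter fed to σ is the summed one and the letter fed to ρ is the traced one.
  let Φ : (Fin q × SpinConfig Λ q × SpinConfig Λ q) ≃ (Fin q × SpinConfig Λ q × SpinConfig Λ q) :=
    { toFun := fun t => (t.2.2 x, Function.update t.2.1 x t.1, Function.update t.2.2 x (t.2.1 x))
      invFun := fun t => (t.2.1 x, Function.update t.2.1 x (t.2.2 x), Function.update t.2.2 x t.1)
      left_inv := fun t => by simp
      right_inv := fun t => by simp }
  refine Fintype.sum_equiv Φ _ _ fun ⟨a, c, d⟩ => ?_
  have h₁ : ∀ k, (insert x A).piecewise (e.symm (a, k)) c =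
      A.piecewise (e.symm (d x, k)) (Function.update c x a) := by
    intro k
    ext y
    by_cases hy : y = x
    · subst hy; simp [hx, ex]
    · by_cases hA : y ∈ A <;> simp [Finset.piecewise, hy, hA, ey a (d x) k y hy]
  have h₂ : ∀ k, (insert x A).piecewise d (e.symm (a, k)) =
      A.piecewise (Function.update d x (c x)) (e.symm (d x, k)) := by
    intro k
    ext y
    by_cases hy : y = x
    · subst hy; simp [hx, ex]
    · by_cases hA : y ∈ A <;> simp [Finset.piecewise, hy, hA, ey a (d x) k y hy]
  simp only [Φ, Equiv.coe_fn_mk, h₁, h₂]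

theorem trace_hybridState {ρ σ : SpinOp Λ q} (hq : 1 ≤ q) (hρ : ρ.trace = 1) (hσ : σ.trace = 1)
    (A : Finset Λ) : (hybridState ρ σ A).trace = 1 := by
  induction A using Finset.induction_on with
  | empty => rw [hybridState_empty hq hσ, hρ]
  | insert x A hx ih =>
    rw [← trace_partialTraceSite x, partialTraceSite_hybridState_insert ρ σ hx,
      trace_partialTraceSite, ih]

/-- Pass from ρ to σ one site at a time through hybrid states and telescope. Consecutive hybrids
agree after tracing out the changed site, and two states are at trace distance at most 2. -/
theorem exists_isW1Decomposition (hq : 1 ≤ q) {ρ σ : SpinOp Λ q} (hρ : IsQuantumState ρ)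
    (hσ : IsQuantumState σ) :
    ∃ D, IsW1Decomposition (ρ - σ) D ∧ ∑ x, traceNorm (D x) ≤ 2 * Fintype.card Λ := by
  set e := Fintype.equivFin Λ
  set A : ℕ → Finset Λ := fun k => Finset.univ.filter fun x => (e x : ℕ) < k
  set h : ℕ → SpinOp Λ q := fun k => hybridState ρ σ (A k)
  have hA : ∀ x, A (e x + 1) = insert x (A (e x)) := by
    intro x
    ext y
    simp only [A, Finset.mem_filter, Finset.mem_univ, true_and, Finset.mem_insert]
    rw [Nat.lt_succ_iff_lt_or_eq, or_comm, ← Fin.ext_iff, e.injective.eq_iff]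
  have h0 : ∀ k, 0 ≤ h k := fun k =>
    hybridState_nonneg hρ.posSemidef.nonneg hσ.posSemidef.nonneg _
  have ht : ∀ k, (h k).trace = 1 := fun k =>
    trace_hybridState hq hρ.trace_eq_one hσ.trace_eq_one _
  have hh : ∀ k, (h k).IsHermitian := fun k => (Matrix.nonneg_iff_posSemidef.mp (h0 k)).isHermitian
  refine ⟨fun x => h (e x) - h (e x + 1), ⟨fun x => ⟨(hh _).sub (hh _), ?_⟩, fun x => ?_, ?_⟩, ?_⟩
  · rw [Matrix.trace_sub, ht, ht, sub_self]
  · have hsub : ∀ X Y : SpinOp Λ q,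
        partialTraceSite x (X - Y) = partialTraceSite x X - partialTraceSite x Y := by
      intro X Y; ext i j; simp [partialTraceSite]
    rw [hsub, sub_eq_zero]
    simp only [h, hA]
    exact (partialTraceSite_hybridState_insert ρ σ (by simp [A])).symm
  · rw [e.sum_comp fun k : Fin (Fintype.card Λ) => h k - h (k + 1),
      Fin.sum_univ_eq_sum_range (fun k => h k - h (k + 1)), Finset.sum_range_sub']
    have e0 : A 0 = ∅ := by simp [A]
    have en : A (Fintype.card Λ) = Finset.univ := by simp [A]
    simp only [h, e0, en, hybridState_empty hq hσ.trace_eq_one,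
      hybridState_univ hq hρ.trace_eq_one]
  · calc _ ≤ ∑ _x : Λ, (2 : ℝ) := Finset.sum_le_sum fun x _ => by
          have := Matrix.traceNorm_sub_le (h0 (e x)) (h0 (e x + 1))
          rw [ht, ht, Complex.one_re] at this
          linarith
      _ = _ := by simp [mul_comm]

theorem quantumW1Norm_nonneg (Δ : SpinOp Λ q) : 0 ≤ quantumW1Norm Δ := by
  refine mul_nonneg (by norm_num) (Real.sInf_nonneg ?_)
  rintro _ ⟨D, -, rfl⟩
  exact Finset.sum_nonneg fun x _ => Matrix.traceNorm_nonneg _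

theorem quantumW1Norm_le_card (hq : 1 ≤ q) {ρ σ : SpinOp Λ q} (hρ : IsQuantumState ρ)
    (hσ : IsQuantumState σ) : quantumW1Norm (ρ - σ) ≤ Fintype.card Λ := by
  obtain ⟨D, hD, hle⟩ := exists_isW1Decomposition hq hρ hσ
  have : sInf {s : ℝ | ∃ D : Λ → SpinOp Λ q, IsW1Decomposition (ρ - σ) D ∧
      s = ∑ x, traceNorm (D x)} ≤ ∑ x, traceNorm (D x) := by
    refine csInf_le ⟨0, ?_⟩ ⟨D, hD, rfl⟩
    rintro _ ⟨D, -, rfl⟩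
    exact Finset.sum_nonneg fun x _ => Matrix.traceNorm_nonneg _
  rw [quantumW1Norm]
  linarith

theorem IsW1Decomposition.neg {Δ : SpinOp Λ q} {D : Λ → SpinOp Λ q} (h : IsW1Decomposition Δ D) :
    IsW1Decomposition (-Δ) (-D) where
  traceless x := ⟨(h.traceless x).isHermitian.neg, by
    rw [Pi.neg_apply, Matrix.trace_neg, (h.traceless x).trace_eq_zero, neg_zero]⟩
  partialTrace_eq_zero x := by
    have := h.partialTrace_eq_zero x
    ext i j
    have hij := congrFun (congrFun this i) j
    simp only [partialTraceSite, Matrix.of_apply, Matrix.zero_apply] at hij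
    simp [partialTraceSite, hij]
  sum_eq := by simp [h.sum_eq]

theorem quantumW1Norm_neg (Δ : SpinOp Λ q) : quantumW1Norm (-Δ) = quantumW1Norm Δ := by
  have key : ∀ Δ : SpinOp Λ q, ∀ s : ℝ,
      (∃ D : Λ → SpinOp Λ q, IsW1Decomposition Δ D ∧ s = ∑ x, traceNorm (D x)) →
      ∃ D : Λ → SpinOp Λ q, IsW1Decomposition (-Δ) D ∧ s = ∑ x, traceNorm (D x) := by
    rintro Δ _ ⟨D, hD, rfl⟩
    exact ⟨-D, hD.neg, by simp [Matrix.traceNorm_neg]⟩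
  rw [quantumW1Norm, quantumW1Norm]
  congr 2
  ext s
  exact ⟨fun h => by simpa using key _ s h, key Δ s⟩

end Hybrid

/-! ### Choice of the depolarizing strength and the final case analysis. -/

section Continuity
variable {Λ : Type*} [Fintype Λ] [DecidableEq Λ] {q : ℕ}

theorem entropy_sub_le_quantumW1Norm (hq : 2 ≤ q) {ρ σ : SpinOp Λ q} (hρ : IsQuantumState ρ)
    (hσ : IsQuantumState σ) {p : ℝ} (hp₀ : 0 < p) (hp₁ : p ≤ 1 - 1 / (q : ℝ) ^ 2) :
    vonNeumannEntropy σ - vonNeumannEntropy ρ ≤ -(Fintype.card Λ * Real.log (1 - p)) +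
      Real.log ((1 - p) * ((q : ℝ) ^ 2 - 1) / p) * quantumW1Norm (ρ - σ) := by
  have hq' : (2 : ℝ) ≤ q := by exact_mod_cast hq
  have hq2 : 0 < (q : ℝ) ^ 2 := by positivity
  have hQ : 0 < (q : ℝ) ^ 2 - 1 := by nlinarith
  have hpq : p * (q : ℝ) ^ 2 ≤ (q : ℝ) ^ 2 - 1 := by
    have := mul_le_mul_of_nonneg_right hp₁ hq2.le
    rwa [sub_mul, one_mul, div_mul_cancel₀ _ hq2.ne'] at this
  -- The solution of 1 - s + s/q² = 1 - p; the upper bound on p is equivalent to s ≤ 1.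
  set s := p * (q : ℝ) ^ 2 / ((q : ℝ) ^ 2 - 1) with hs
  have hs₀ : 0 < s := by positivity
  have hs₁ : s ≤ 1 := (div_le_one hQ).mpr hpq
  have hc : 1 - s + s / (q : ℝ) ^ 2 = 1 - p := by
    rw [hs]; field_simp; ring
  have hb : ((1 - s) * (q : ℝ) ^ 2 + s) / s = (1 - p) * ((q : ℝ) ^ 2 - 1) / p := by
    have : (1 - s) * (q : ℝ) ^ 2 + s = (1 - p) * (q : ℝ) ^ 2 := by
      rw [← hc, add_mul, div_mul_cancel₀ _ hq2.ne']
    rw [this, hs]; field_simp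
  set L := Real.log ((1 - p) * ((q : ℝ) ^ 2 - 1) / p)
  have hL : 0 ≤ L := Real.log_nonneg (by rw [one_le_div hp₀]; nlinarith)
  have key : ∀ D : Λ → SpinOp Λ q, IsW1Decomposition (ρ - σ) D →
      vonNeumannEntropy σ - vonNeumannEntropy ρ ≤ -(Fintype.card Λ * Real.log (1 - p)) +
        1 / 2 * L * ∑ x, traceNorm (D x) := by
    intro D hD
    have := entropy_sub_le_of_decomposition (by omega) hρ hσ hD hs₀ hs₁
    rwa [hc, hb] at this
  obtain ⟨D₀, hD₀, -⟩ := exists_isW1Decomposition (by omega) hρ hσ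
  -- Passing to the infimum divides by L, so L = 0 is treated apart; there any decomposition will
  -- do.
  rcases hL.eq_or_lt with h0 | hpos
  · have := key D₀ hD₀
    rw [← h0] at this ⊢
    linarith
  · have hinf : (vonNeumannEntropy σ - vonNeumannEntropy ρ +
        Fintype.card Λ * Real.log (1 - p)) / (1 / 2 * L) ≤
        sInf {s : ℝ | ∃ D : Λ → SpinOp Λ q, IsW1Decomposition (ρ - σ) D ∧
          s = ∑ x, traceNorm (D x)} := by
      refine le_csInf ⟨_, D₀, hD₀, rfl⟩ ?_
      rintro _ ⟨D, hD, rfl⟩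
      rw [div_le_iff₀ (by positivity)]
      linarith [key D hD]
    rw [div_le_iff₀ (by positivity)] at hinf
    rw [quantumW1Norm]
    linarith

/-- For r ≥ 2 the threshold is at least 3/4, so 4 ln r ≤ 3 ln(r² - 1) is enough; this is the
polynomial inequality `hpow`. -/
theorem log_le_mul_log_sq_sub_one {r p : ℝ} (hr : 2 ≤ r) (hp : 1 - 1 / r ^ 2 ≤ p) :
    Real.log r ≤ p * Real.log (r ^ 2 - 1) := by
  have h4 : 4 ≤ r ^ 2 := by nlinarith
  have hp' : 3 / 4 ≤ p := by
    have : 1 / r ^ 2 ≤ 1 / 4 := one_div_le_one_div_of_le (by norm_num) h4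
    linarith
  have h3 : 0 ≤ Real.log (r ^ 2 - 1) := Real.log_nonneg (by linarith)
  have hpow : r ^ 4 ≤ (r ^ 2 - 1) ^ 3 := by
    set t := r ^ 2
    have : r ^ 4 = t ^ 2 := by ring
    rw [this]
    have : 0 ≤ t * (t * (t - 4) + 3) := by
      have : 0 ≤ t * (t - 4) := mul_nonneg (by linarith) (by linarith)
      exact mul_nonneg (by linarith) (by linarith)
    nlinarith
  have hlog := Real.log_le_log (by positivity) hpow
  rw [Real.log_pow, Real.log_pow] at hlog
  push_cast at hlog
  have := mul_le_mul_of_nonneg_right hp' h3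
  linarith

theorem entropy_sub_le_binEntropy [Nonempty Λ] (hq : 1 ≤ q) {ρ σ : SpinOp Λ q}
    (hρ : IsQuantumState ρ) (hσ : IsQuantumState σ) :
    (vonNeumannEntropy σ - vonNeumannEntropy ρ) / (Fintype.card Λ : ℝ) ≤
      Real.binEntropy (quantumW1Norm (ρ - σ) / (Fintype.card Λ : ℝ)) +
        quantumW1Norm (ρ - σ) / (Fintype.card Λ : ℝ) * Real.log ((q : ℝ) ^ 2 - 1) := by
  have hn : (0 : ℝ) < Fintype.card Λ := by exact_mod_cast Fintype.card_pos
  set w := quantumW1Norm (ρ - σ)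
  set n : ℝ := (Fintype.card Λ : ℝ)
  set p := w / n
  have hw : w = p * n := (div_mul_cancel₀ _ hn.ne').symm
  have hp₀ : 0 ≤ p := div_nonneg (quantumW1Norm_nonneg _) hn.le
  have hp₁ : p ≤ 1 := (div_le_one hn).mpr (quantumW1Norm_le_card hq hρ hσ)
  have hbin : 0 ≤ Real.binEntropy p := Real.binEntropy_nonneg hp₀ hp₁
  -- For q = 1 the space is one-dimensional and the two states coincide; the term ln(q² - 1) is
  -- `Real.log 0 = 0`.
  rcases hq.eq_or_lt with rfl | hq2
  · have : ρ = σ := by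
      ext i j
      have h₁ := hρ.trace_eq_one
      have h₂ := hσ.trace_eq_one
      rw [Matrix.trace, Fintype.sum_subsingleton _ i, Matrix.diag_apply] at h₁ h₂
      rw [Subsingleton.elim j i, h₁, h₂]
    simp [this] at hbin ⊢
    simpa [p, w, this] using hbin
  have hq' : (2 : ℝ) ≤ q := by exact_mod_cast hq2
  have hQ : 0 < (q : ℝ) ^ 2 - 1 := by nlinarith
  rcases le_or_gt p (1 - 1 / (q : ℝ) ^ 2) with hp | hp
  -- The choice p = W₁/n requires p > 0. When W₁ = 0, any small t > 0 serves as parameter instead,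
  -- and t → 0.
  · rcases hp₀.eq_or_lt with h0 | hpos
    · have hw0 : w = 0 := by rw [hw, ← h0, zero_mul]
      rw [← h0, Real.binEntropy_zero, zero_mul, add_zero]
      refine div_nonpos_of_nonpos_of_nonneg ?_ hn.le
      have hpq : 0 < 1 - 1 / (q : ℝ) ^ 2 := by
        rw [sub_pos, div_lt_one (by positivity)]; linarith
      have hlim : Filter.Tendsto (fun t : ℝ => -(n * Real.log (1 - t)))
          (nhdsWithin 0 (Set.Ioi 0)) (nhds 0) := by
        have : ContinuousAt (fun t : ℝ => -(n * Real.log (1 - t))) 0 :=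
          (continuousAt_const.mul (ContinuousAt.log (by fun_prop) (by norm_num))).neg
        simpa using this.tendsto.mono_left nhdsWithin_le_nhds
      refine ge_of_tendsto hlim ?_
      filter_upwards [Ioo_mem_nhdsGT hpq] with t ht
      have := entropy_sub_le_quantumW1Norm hq2 hρ hσ ht.1 ht.2.le
      rwa [show quantumW1Norm (ρ - σ) = 0 from hw0, mul_zero, add_zero] at this
    · have h1p : 0 < 1 - p := by
        have : 0 < 1 / (q : ℝ) ^ 2 := by positivity
        linarith
      have := entropy_sub_le_quantumW1Norm hq2 hρ hσ hpos hp
      rw [div_le_iff₀ hn]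
      refine this.trans (le_of_eq ?_)
      change -(n * _) + _ * w = _
      rw [hw, Real.binEntropy, Real.log_div (mul_pos h1p hQ).ne' hpos.ne',
        Real.log_mul h1p.ne' hQ.ne', Real.log_inv, Real.log_inv]
      ring
  -- Beyond the threshold the crude estimate S(σ) - S(ρ) ≤ n ln q already suffices.
  · have h₁ := Matrix.vonNeumannEntropy_nonneg hρ.posSemidef hρ.trace_eq_one
    have h₂ := Matrix.vonNeumannEntropy_le_log_card hσ.posSemidef hσ.trace_eq_one
    have hcard : Real.log (Fintype.card (SpinConfig Λ q)) = n * Real.log q := by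
      simp [n, Real.log_pow]
    have h₃ := log_le_mul_log_sq_sub_one hq' hp.le
    refine le_trans ?_ (h₃.trans (le_add_of_nonneg_left hbin))
    rw [div_le_iff₀ hn]
    linarith

end Continuity

end

theorem mainTheorem1 {Λ : Type*} [Fintype Λ] [DecidableEq Λ] [Nonempty Λ] (q : ℕ) (hq : 1 ≤ q)
    (ρ σ : SpinOp Λ q) (hρ : IsQuantumState ρ) (hσ : IsQuantumState σ) :
    |vonNeumannEntropy ρ - vonNeumannEntropy σ| / (Fintype.card Λ : ℝ) ≤
      Real.binEntropy (quantumW1Norm (ρ - σ) / (Fintype.card Λ : ℝ)) +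
        quantumW1Norm (ρ - σ) / (Fintype.card Λ : ℝ) * Real.log ((q : ℝ) ^ 2 - 1) := by
  rcases abs_choice (vonNeumannEntropy ρ - vonNeumannEntropy σ) with h | h
  · rw [h, ← quantumW1Norm_neg (ρ - σ), neg_sub]
    exact entropy_sub_le_binEntropy hq hσ hρ
  · rw [h, neg_sub]
    exact entropy_sub_le_binEntropy hq hρ hσ
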